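/- A bcm space is a non-empty metric space in which every closed ball is compact. Let $\mathsf{BCM}$ be the category of bcm spaces with isometric (distance-preserving) embeddings, $\mathsf{rBCM}$ the category of rooted bcm spaces $(X,\rho_X)$, $\rho_X\in X$, with root-preserving isometric embeddings, and $\mathsf{MTop}$ the category of metrizable topological spaces with topological embeddings. Let $\tau:\mathsf{BCM}\to\mathsf{MTop}$ be a functor; write $\tau_f:\tau(X)\to\tau(Y)$ for the map assigned to $f:X\to Y$, and $\tau^\bullet:\mathsf{rBCM}\to\mathsf{MTop}$ for the functor $\tau^\bullet(X,\rho_X)=\tau(X)$, $\tau^\bullet_f=\tau_f$. Assume that: (a) $\tau$ is space-rooted metrizable, i.e. there are metrics $d^{\tau}_{X,\rho_X}$ on $\tau(X)$, one for each rooted bcm space $(X,\rho_X)$, that induce the given topology of $\tau(X)$ and for which $\tau_f$ is distance-preserving for every root-preserving isometric embedding $f:(X,\rho_X)\to(Y,\rho_Y)$. Fix such a family. (b) $\tau$ is embedding-continuous, i.e. whenever isometric embeddings $f_n:X\to Y$ of bcm spaces converge, uniformly on compact sets, to an isometric embedding $f$, then $\tau_{f_n}(a)\to\tau_f(a)$ for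 every $a\in\tau(X)$. For a bcm space $Z$, $\rho\in Z$ and closed $A,B\subseteq Z$ put $$d_{Z,\rho}(A,B)=\int_0^\infty e^{-r}\bigl(1\wedge d_H(A\cap D_Z(\rho,r),\,B\cap D_Z(\rho,r))\bigr)\,dr,$$ where $D_Z(\rho,r)$ is the closed ball and $d_H$ is the Hausdorff (extended) distance. Let $\mathfrak M_\bullet$ be the set of rooted bcm spaces up to root-preserving isometry, with the local Gromov--Hausdorff topology, induced by the metric $$d\bigl((X,\rho_X),(Y,\rho_Y)\bigr)=\inf_{f,g,Z} d_{Z,\rho_Z}(f(X),g(Y)).$$ Let $\mathfrak M_\bullet(\tau)$ be the set of triples $(X,\rho_X,a_X)$ with $(X,\rho_X)$ a rooted bcm space and $a_X\in\tau(X)$, where two triples are identified if there is a root-preserving isometry $f:X\to Y$ with $\tau_f(a_X)=a_Y$. Equip it with the local GH-type topology with preserved roots, induced by the metric $$d\bigl((X,\rho_X,a_X),(Y,\rho_Y,a_Y)\bigr)=\inf_{f,g,Z}\Bigl\{d_{Z,\rho_Z}(f(X),g(Y))\vee d^{\tau}_{Z,\rho_Z}\bigl(\tau_f(a_X),\tau_g(a_Y)\bigr)\Bigr\}.$$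 Both infima are over all rooted bcm spaces $(Z,\rho_Z)$ and root-preserving isometric embeddings $f:X\to Z$, $g:Y\to Z$. A subfunctor $\tau'$ of $\tau^\bullet$ is a choice of subsets $\tau'(X,\rho_X)\subseteq\tau(X)$ (with the relative topology) such that $\tau_f(\tau'(X,\rho_X))\subseteq\tau'(Y,\rho_Y)$ for every root-preserving isometric embedding $f:X\to Y$. A subset of a topological space is precompact if its closure is compact; $\tau'$ is precompact if $\tau'(X,\rho_X)$ is precompact in $\tau(X)$ for every $(X,\rho_X)$. The functor $\tau$ is upper semicontinuous if, whenever bcm spaces $X_n$ ($n\in\mathbb N$) and $X_\infty$ are isometrically embedded in a bcm space $Y$ by maps $f_n$ and $f_\infty$ so that $f_n(X_n)\to f_\infty(X_\infty)$ in the Fell topology on the closed subsets of $Y$, and $a_n\in\tau(X_n)$ are such that $\tau_{f_n}(a_n)$ converges in $\tau(Y)$ to some $b$, then $b\in\tau_{f_\infty}(\tau(X_\infty))$. Theorem. Let $\{\mathcal X_\alpha=(X_\alpha,\rho_\alpha,a_\alpha)\mid\alpha\in\mathscr A\}$ be a non-empty family in $\mathfrak M_\bullet(\tau)$. Consider the statements: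 (i) $\{\mathcal X_\alpha\mid\alpha\in\mathscr A\}$ is precompact in $\mathfrak M_\bullet(\tau)$; (ii) $\{(X_\alpha,\rho_\alpha)\mid\alpha\in\mathscr A\}$ is precompact in $\mathfrak M_\bullet$, and there is a precompact subfunctor $\tau'$ of $\tau^\bullet$ such that $a_\alpha\in\tau'(X_\alpha,\rho_\alpha)$ for all $\alpha\in\mathscr A$. Then (i) implies (ii). If moreover $\tau$ is upper semicontinuous, then (ii) implies (i). -/

import Mathlib

open CategoryTheory Filter Topology Set
open scoped ENNReal

universe u v w

namespace GHStruct

/-! ## Boundedly compact metric spaces and the categories involved -/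

/-- A boundedly compact metric space (bcm space): a non-empty metric space all of whose closed
balls are compact. -/
structure BCM : Type (u + 1) where
  carrier : Type u
  [metricSpace : MetricSpace carrier]
  [properSpace : ProperSpace carrier]
  [nonempty : Nonempty carrier]

namespace BCM

instance : CoeSort BCM.{u} (Type u) := ⟨BCM.carrier⟩

attribute [instance] BCM.metricSpace BCM.properSpace BCM.nonempty

/-- Morphisms of bcm spaces: isometric (i.e. distance-preserving) embeddings. -/
@[ext]
structure Hom (X Y : BCM.{u}) : Type u where
  toFun : X → Y
  isometry : Isometry toFun

instance : Category BCM.{u} where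
  Hom := Hom
  id X := ⟨id, isometry_id⟩
  comp f g := ⟨g.toFun ∘ f.toFun, g.isometry.comp f.isometry⟩

end BCM

/-- A rooted bcm space `(X, ρ)`. -/
structure RBCM : Type (u + 1) where
  space : BCM.{u}
  root : space

namespace RBCM

/-- Morphisms of rooted bcm spaces: root-preserving isometric embeddings. -/
@[ext]
structure Hom (X Y : RBCM.{u}) : Type u where
  toHom : X.space ⟶ Y.space
  map_root : toHom.toFun X.root = Y.root

instance : Category RBCM.{u} where
  Hom := Hom
  id X := ⟨𝟙 X.space, rfl⟩
  comp f g := ⟨f.toHom ≫ g.toHom, (congrArg g.toHom.toFun f.map_root).trans g.map_root⟩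

/-- The functor forgetting the root. -/
def forgetRoot : RBCM.{u} ⥤ BCM.{u} where
  obj X := X.space
  map f := f.toHom

end RBCM

/-- A metrizable topological space. -/
structure MTop : Type (v + 1) where
  carrier : Type v
  [topologicalSpace : TopologicalSpace carrier]
  [metrizableSpace : TopologicalSpace.MetrizableSpace carrier]

namespace MTop

instance : CoeSort MTop.{v} (Type v) := ⟨MTop.carrier⟩

attribute [instance] MTop.topologicalSpace MTop.metrizableSpace

/-- Morphisms of metrizable spaces: topological embeddings. -/
@[ext]
structure Hom (X Y : MTop.{v}) : Type v where
  toFun : X → Y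
  isEmbedding : IsEmbedding toFun

instance : Category MTop.{v} where
  Hom := Hom
  id X := ⟨id, IsEmbedding.id⟩
  comp f g := ⟨g.toFun ∘ f.toFun, g.isEmbedding.comp f.isEmbedding⟩

end MTop

/-- A structure: a functor from bcm spaces to metrizable topological spaces. -/
abbrev Structure := BCM.{u} ⥤ MTop.{v}

/-- The functor `τ^•` on rooted bcm spaces, `τ^•(X, ρ) = τ(X)`. -/
abbrev Structure.rooted (τ : Structure.{u, v}) : RBCM.{u} ⥤ MTop.{v} := RBCM.forgetRoot ⋙ τ

/-- A subfunctor of `F`: a subset (with the relative topology) of `F(X)` for each `X`, preserved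
by the maps `F_f`, the action on morphisms being by restriction. -/
structure MSubfunctor {C : Type*} [Category C] (F : C ⥤ MTop.{v}) where
  obj : ∀ X : C, Set (F.obj X)
  map_mem : ∀ {X Y : C} (f : X ⟶ Y) {a : F.obj X}, a ∈ obj X → (F.map f).toFun a ∈ obj Y

/-- `s` is precompact (i.e. its closure is compact) in the topology `t`. -/
def IsPrecompact {α : Type*} (t : TopologicalSpace α) (s : Set α) : Prop :=
  letI := t
  IsCompact (closure s)

/-- A subfunctor is precompact if each of its values is precompact. -/
def MSubfunctor.IsPrecompact {C : Type*} [Category C] {F : C ⥤ MTop.{v}}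
    (S : MSubfunctor F) : Prop :=
  ∀ X : C, GHStruct.IsPrecompact inferInstance (S.obj X)

/-! ## Hypotheses on structures -/

/-- A space-rooted metrization of `τ`: for each rooted bcm space `(X, ρ)`, a metric on `τ(X)`
inducing the given topology, such that `τ_f` is distance-preserving for each root-preserving
isometric embedding `f`. -/
structure SpaceRootedMetrization (τ : Structure.{u, v}) where
  metric : ∀ X : RBCM.{u}, MetricSpace (τ.rooted.obj X)
  topology_eq : ∀ X : RBCM.{u},
    (metric X).toUniformSpace.toTopologicalSpace = (τ.rooted.obj X).topologicalSpace
  dist_map : ∀ {X Y : RBCM.{u}} (f : X ⟶ Y) (a b : τ.rooted.obj X),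
    (metric Y).dist ((τ.rooted.map f).toFun a) ((τ.rooted.map f).toFun b) = (metric X).dist a b

/-- Embedding-continuity: if isometric embeddings `f n : X → Y` converge to `g` uniformly on
compact sets, then `τ_{f n}(a) → τ_g(a)` for every `a ∈ τ(X)`. -/
def EmbeddingContinuous (τ : Structure.{u, v}) : Prop :=
  ∀ (X Y : BCM.{u}) (f : ℕ → (X ⟶ Y)) (g : X ⟶ Y),
    (∀ K : Set X, IsCompact K → TendstoUniformlyOn (fun n => (f n).toFun) g.toFun atTop K) →
    ∀ a : τ.obj X, Tendsto (fun n => (τ.map (f n)).toFun a) atTop (𝓝 ((τ.map g).toFun a))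

/-- The Fell topology on the closed subsets of `Y`, generated by the sets
`{A | A ∩ K = ∅}` with `K` compact and `{A | A ∩ G ≠ ∅}` with `G` open. -/
abbrev fellTopology (Y : Type*) [TopologicalSpace Y] :
    TopologicalSpace (TopologicalSpace.Closeds Y) :=
  TopologicalSpace.generateFrom
    ({U | ∃ K : Set Y, IsCompact K ∧ U = {A : TopologicalSpace.Closeds Y | (A : Set Y) ∩ K = ∅}} ∪
      {U | ∃ G : Set Y, IsOpen G ∧
      U = {A : TopologicalSpace.Closeds Y | ((A : Set Y) ∩ G).Nonempty}})

/-- The image `f(X)`, as a closed subset of `Y`. -/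
def BCM.Hom.image {X Y : BCM.{u}} (f : X ⟶ Y) : TopologicalSpace.Closeds Y :=
  ⟨range f.toFun, f.isometry.isClosedEmbedding.isClosed_range⟩

/-- Upper semicontinuity: if `X n`, `X'` are isometrically embedded into `Y` with `X n → X'` in
the Fell topology, and `a n ∈ τ(X n)` converge in `τ(Y)` to `b`, then `b ∈ τ(X')`. -/
def UpperSemicontinuous (τ : Structure.{u, v}) : Prop :=
  ∀ (Y : BCM.{u}) (X : ℕ → BCM.{u}) (X' : BCM.{u}) (f : ∀ n, X n ⟶ Y) (f' : X' ⟶ Y),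
    Tendsto (fun n => BCM.Hom.image (f n)) atTop (@nhds _ (fellTopology Y) (BCM.Hom.image f')) →
    ∀ (a : ∀ n, τ.obj (X n)) (b : τ.obj Y),
      Tendsto (fun n => (τ.map (f n)).toFun (a n)) atTop (𝓝 b) →
      b ∈ range (τ.map f').toFun

/-! ## Local Gromov--Hausdorff-type topologies -/

/-- The local Hausdorff metric
`∫₀^∞ e^{-r} (1 ∧ d_H(A ∩ D(ρ, r), B ∩ D(ρ, r))) dr`, with `D(ρ, r)` the closed ball. -/
noncomputable def localHausdorff {X : Type*} [MetricSpace X] (ρ : X) (A B : Set X) : ℝ≥0∞ :=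
  ∫⁻ r in Ioi (0 : ℝ), ENNReal.ofReal (Real.exp (-r)) *
    min 1 (Metric.hausdorffEDist (A ∩ Metric.closedBall ρ r) (B ∩ Metric.closedBall ρ r))

/-- The topology induced by a distance function `d`: a set is open if it contains a `d`-ball of
positive radius around each of its points. -/
abbrev distTopology {α : Type*} (d : α → α → ℝ≥0∞) : TopologicalSpace α where
  IsOpen U := ∀ x ∈ U, ∃ ε : ℝ≥0∞, 0 < ε ∧ ∀ y, d x y < ε → y ∈ U
  isOpen_univ := fun _ _ => ⟨1, one_pos, fun _ _ => mem_univ _⟩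
  isOpen_inter := by
    rintro s t hs ht x ⟨hxs, hxt⟩
    obtain ⟨ε, hε, h⟩ := hs x hxs
    obtain ⟨δ, hδ, h'⟩ := ht x hxt
    exact ⟨min ε δ, lt_min hε hδ, fun y hy =>
      ⟨h y (hy.trans_le (min_le_left _ _)), h' y (hy.trans_le (min_le_right _ _))⟩⟩
  isOpen_sUnion := by
    rintro S hS x ⟨s, hs, hxs⟩
    obtain ⟨ε, hε, h⟩ := hS s hs x hxs
    exact ⟨ε, hε, fun y hy => ⟨s, hs, h y hy⟩⟩

/-- The inverse of a bijective root-preserving isometry. -/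
theorem RBCM.exists_inverse {X Y : RBCM.{u}} (f : X ⟶ Y)
    (hf : Function.Surjective f.toHom.toFun) : ∃ g : Y ⟶ X, f ≫ g = 𝟙 X ∧ g ≫ f = 𝟙 Y := by
  obtain ⟨g, hg⟩ := hf.hasRightInverse
  have hgi : Isometry g := f.toHom.isometry.right_inv hg
  have hinj := f.toHom.isometry.injective
  refine ⟨⟨⟨g, hgi⟩, hinj ((hg _).trans f.map_root.symm)⟩, ?_, ?_⟩
  · apply RBCM.Hom.ext
    apply BCM.Hom.ext
    funext x
    exact hinj (hg _)
  · apply RBCM.Hom.ext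
    apply BCM.Hom.ext
    funext y
    exact hg y

/-! ### Rooted bcm spaces -/

/-- Rooted bcm spaces are identified when there is a root-preserving isometry between them. -/
instance RBCM.setoid : Setoid RBCM.{u} where
  r X Y := ∃ f : X ⟶ Y, Function.Surjective f.toHom.toFun
  iseqv :=
    { refl := fun X => ⟨𝟙 X, fun x => ⟨x, rfl⟩⟩
      symm := by
        rintro X Y ⟨f, hf⟩
        obtain ⟨g, hfg, -⟩ := RBCM.exists_inverse f hf
        exact ⟨g, fun x => ⟨f.toHom.toFun x, congrArg (fun h => h.toHom.toFun x) hfg⟩⟩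
      trans := by
        rintro X Y Z ⟨f, hf⟩ ⟨g, hg⟩
        exact ⟨f ≫ g, hg.comp hf⟩ }

/-- The set of rooted bcm spaces up to rooted isometry. -/
def RootedGH : Type (u + 1) := Quotient RBCM.setoid.{u}

/-- The infimum of the local Hausdorff distance of `f(X)` and `g(Y)` over all root-preserving
isometric embeddings `f`, `g` of `X`, `Y` into a common rooted bcm space `Z`. -/
noncomputable def RBCM.ghDist (X Y : RBCM.{u}) : ℝ≥0∞ :=
  ⨅ (Z : RBCM.{u}) (f : X ⟶ Z) (g : Y ⟶ Z),
    localHausdorff Z.root (range f.toHom.toFun) (range g.toHom.toFun)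

theorem range_comp_surjective {X X' Z : RBCM.{u}} (h : X' ⟶ X)
    (hh : Function.Surjective h.toHom.toFun) (f : X ⟶ Z) :
    range (h ≫ f).toHom.toFun = range f.toHom.toFun :=
  hh.range_comp f.toHom.toFun

theorem RBCM.ghDist_le {X Y X' Y' : RBCM.{u}} (hX : X ≈ X') (hY : Y ≈ Y') :
    RBCM.ghDist X Y ≤ RBCM.ghDist X' Y' := by
  obtain ⟨h, hh⟩ := hX
  obtain ⟨k, hk⟩ := hY
  refine le_iInf fun Z => le_iInf fun f => le_iInf fun g => ?_
  refine (iInf_le_of_le Z (iInf_le_of_le (h ≫ f) (iInf_le_of_le (k ≫ g) le_rfl))).trans ?_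
  rw [range_comp_surjective h hh, range_comp_surjective k hk]

/-- The local Gromov--Hausdorff metric on rooted bcm spaces up to rooted isometry. -/
noncomputable def RootedGH.dist (p q : RootedGH.{u}) : ℝ≥0∞ :=
  Quotient.liftOn₂ p q RBCM.ghDist fun _ _ _ _ hX hY =>
    le_antisymm (RBCM.ghDist_le hX hY) (RBCM.ghDist_le (Setoid.symm hX) (Setoid.symm hY))

/-- The local Gromov--Hausdorff topology. -/
noncomputable abbrev RootedGH.topology : TopologicalSpace RootedGH.{u} :=
  distTopology RootedGH.dist

/-! ### Rooted bcm spaces with an additional element -/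

/-- A triple `(X, ρ, a)` with `(X, ρ)` a rooted bcm space and `a ∈ τ(X)`. -/
structure Triple (τ : Structure.{u, v}) : Type (max (u + 1) v) where
  base : RBCM.{u}
  elem : τ.rooted.obj base

/-- Triples `(X, ρ, a)` and `(Y, ρ', b)` are identified when there is a root-preserving isometry
`f : X → Y` with `τ_f(a) = b`. -/
instance Triple.setoid (τ : Structure.{u, v}) : Setoid (Triple τ) where
  r 𝒳 𝒴 := ∃ f : 𝒳.base ⟶ 𝒴.base,
    Function.Surjective f.toHom.toFun ∧ (τ.rooted.map f).toFun 𝒳.elem = 𝒴.elem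
  iseqv :=
    { refl := fun 𝒳 => ⟨𝟙 𝒳.base, fun x => ⟨x, rfl⟩,
        congrArg (fun h => MTop.Hom.toFun h 𝒳.elem) (τ.rooted.map_id 𝒳.base)⟩
      symm := by
        rintro 𝒳 𝒴 ⟨f, hf, hfa⟩
        obtain ⟨g, hfg, -⟩ := RBCM.exists_inverse f hf
        refine ⟨g, fun x => ⟨f.toHom.toFun x, congrArg (fun h => h.toHom.toFun x) hfg⟩, ?_⟩
        rw [← hfa]
        have h := τ.rooted.map_comp f g
        rw [hfg, τ.rooted.map_id] at h
        exact (congrArg (fun h => MTop.Hom.toFun h 𝒳.elem) h).symm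
      trans := by
        rintro 𝒳 𝒴 𝒵 ⟨f, hf, hfa⟩ ⟨g, hg, hga⟩
        refine ⟨f ≫ g, hg.comp hf, ?_⟩
        rw [← hga, ← hfa]
        exact congrArg (fun h => MTop.Hom.toFun h 𝒳.elem) (τ.rooted.map_comp f g) }

/-- The set of triples `(X, ρ, a)` up to rooted-`τ`-isometry. -/
def GHSpace (τ : Structure.{u, v}) : Type (max (u + 1) v) := Quotient (Triple.setoid τ)

/-- The underlying rooted bcm space: `(X, ρ, a) ↦ (X, ρ)`. -/
def GHSpace.toRooted {τ : Structure.{u, v}} : GHSpace τ → RootedGH.{u} :=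
  Quotient.map Triple.base fun _ _ ⟨f, hf, _⟩ => ⟨f, hf⟩

/-- The subset of those `(X, ρ, a)` with `a ∈ S(X, ρ)`. -/
def GHSpace.ofSubfunctor {τ : Structure.{u, v}} (S : MSubfunctor τ.rooted) : Set (GHSpace τ) :=
  {p | ∃ 𝒳 : Triple τ, Quotient.mk _ 𝒳 = p ∧ 𝒳.elem ∈ S.obj 𝒳.base}

variable {τ : Structure.{u, v}}

/-- The infimum of
`localHausdorff (f(X)) (g(Y)) ∨ d_{Z, ρ_Z}(τ_f(a), τ_g(b))` over all root-preserving isometric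
embeddings `f`, `g` of `X`, `Y` into a common rooted bcm space `Z`. -/
noncomputable def Triple.ghDist (σ : SpaceRootedMetrization τ) (𝒳 𝒴 : Triple τ) : ℝ≥0∞ :=
  ⨅ (Z : RBCM.{u}) (f : 𝒳.base ⟶ Z) (g : 𝒴.base ⟶ Z),
    max (localHausdorff Z.root (range f.toHom.toFun) (range g.toHom.toFun))
      (ENNReal.ofReal ((σ.metric Z).dist
        ((τ.rooted.map f).toFun 𝒳.elem) ((τ.rooted.map g).toFun 𝒴.elem)))

theorem Triple.ghDist_le (σ : SpaceRootedMetrization τ) {𝒳 𝒴 𝒳' 𝒴' : Triple τ}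
    (hX : 𝒳 ≈ 𝒳') (hY : 𝒴 ≈ 𝒴') : Triple.ghDist σ 𝒳 𝒴 ≤ Triple.ghDist σ 𝒳' 𝒴' := by
  obtain ⟨h, hh, ha⟩ := hX
  obtain ⟨k, hk, hb⟩ := hY
  refine le_iInf fun Z => le_iInf fun f => le_iInf fun g => ?_
  refine (iInf_le_of_le Z (iInf_le_of_le (h ≫ f) (iInf_le_of_le (k ≫ g) le_rfl))).trans ?_
  rw [range_comp_surjective h hh, range_comp_surjective k hk, ← ha, ← hb,
    τ.rooted.map_comp h f, τ.rooted.map_comp k g]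
  exact le_rfl

/-- The metric on `GHSpace τ` associated with a space-rooted metrization of `τ`. -/
noncomputable def GHSpace.dist (σ : SpaceRootedMetrization τ) (p q : GHSpace τ) : ℝ≥0∞ :=
  Quotient.liftOn₂ p q (Triple.ghDist σ) fun _ _ _ _ hX hY =>
    le_antisymm (Triple.ghDist_le σ hX hY)
      (Triple.ghDist_le σ (Setoid.symm hX) (Setoid.symm hY))

/-- The local GH-type topology with preserved roots. -/
noncomputable abbrev GHSpace.topology (σ : SpaceRootedMetrization τ) : TopologicalSpace (GHSpace τ) :=
  distTopology (GHSpace.dist σ)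

end GHStruct

namespace GHStruct

/-! ## Precompactness in terms of subsequences -/

/-! Gluing two couplings along a common space gives the triangle inequality for both distances. They
are therefore pseudometrics, and precompactness can be tested on sequences. The tool for both
implications is an amalgam: countably many rooted bcm spaces `W n` containing one space `Y` are
glued along `Y`, and the result is again a bcm space provided that on every ball all but finitely
many `W n` lie close to `Y` (`properSpace_of_family`, `RBCM.exists_amalgam`).

(i) ⇒ (ii). Forgetting the element does not increase distances. For τ' take the subfunctor generated
by the given elements, so τ'(Y) consists of all τ_f(a_α) with f : X_α → Y. Given a sequence
τ_{f_n}(a_n) in τ(Y), the triples converge along a subsequence to some (P, ρ, a). Couplings of X_n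
with P, glued to Y along X_n and then to each other along Y, give one space V containing Y and
copies k_n(P) that approach Y locally. By Arzelà–Ascoli some k_n converge to an embedding H, whose
image lies in the closed set Y. Embedding-continuity gives τ_{k_n}(a) → τ_H(a). Since
root-preserving maps preserve the metrics on τ, τ_{f_n}(a_n) is asymptotic to τ_{k_n}(a) in τ(V),
hence converges in τ(Y). This is `exists_subseq_tendsto_map`.

(ii) ⇒ (i). If X_n → X, couplings are glued along X into one space V, where X_n → X in the Fell
topology. The images of the a_n lie in the precompact set τ'(V), so a subsequence converges to some
b, and upper semicontinuity puts b in the image of τ(X). This is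
`isPrecompact_of_upperSemicontinuous`. -/

theorem tendsto_inv_succ : Tendsto (fun n : ℕ => ((n : ℝ≥0∞) + 1)⁻¹) atTop (𝓝 0) := by
  simpa using (tendsto_add_atTop_iff_nat 1).2 ENNReal.tendsto_inv_nat_nhds_zero

/-- A sequence in the closure is shadowed, at distance less than 1/(n+1), by a sequence in `s`, so
it suffices to test sequences in `s`. -/
theorem isCompact_closure_iff_subseq {α : Type*} [PseudoEMetricSpace α] {s : Set α} :
    IsCompact (closure s) ↔ ∀ x : ℕ → α, (∀ n, x n ∈ s) →
      ∃ (a : α) (φ : ℕ → ℕ), StrictMono φ ∧ Tendsto (fun n => x (φ n)) atTop (𝓝 a) := by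
  constructor
  · intro h x hx
    obtain ⟨a, -, φ, hφ, ha⟩ := h.isSeqCompact fun n => subset_closure (hx n)
    exact ⟨a, φ, hφ, ha⟩
  · intro h
    apply IsSeqCompact.isCompact
    intro x hx
    have hpos : ∀ n : ℕ, (0 : ℝ≥0∞) < ((n : ℝ≥0∞) + 1)⁻¹ := fun n =>
      ENNReal.inv_pos.2 (by finiteness)
    choose y hys hy using fun n => EMetric.mem_closure_iff.1 (hx n) _ (hpos n)
    obtain ⟨a, φ, hφ, ha⟩ := h y hys
    have hxa : Tendsto (fun n => x (φ n)) atTop (𝓝 a) := by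
      rw [tendsto_iff_edist_tendsto_0] at ha ⊢
      have hsum := (tendsto_inv_succ.comp hφ.tendsto_atTop).add ha
      rw [add_zero] at hsum
      refine tendsto_of_tendsto_of_tendsto_of_le_of_le tendsto_const_nhds hsum
        (fun _ => zero_le) fun n => ?_
      exact (edist_triangle _ (y (φ n)) _).trans (add_le_add_left (hy (φ n)).le _)
    exact ⟨a, isClosed_closure.mem_of_tendsto hxa (Eventually.of_forall fun n => hx _), φ, hφ, hxa⟩

/-- The pseudometric space structure given by a distance function. -/
noncomputable abbrev pseudoEMetricOfDist {α : Type*} (d : α → α → ℝ≥0∞) (h0 : ∀ x, d x x = 0)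
    (hs : ∀ x y, d x y = d y x) (ht : ∀ x y z, d x z ≤ d x y + d y z) : PseudoEMetricSpace α where
  edist := d
  edist_self := h0
  edist_comm := hs
  edist_triangle := ht

theorem distTopology_eq {α : Type*} (d : α → α → ℝ≥0∞) (h0 : ∀ x, d x x = 0)
    (hs : ∀ x y, d x y = d y x) (ht : ∀ x y z, d x z ≤ d x y + d y z) :
    distTopology d = (pseudoEMetricOfDist d h0 hs ht).toUniformSpace.toTopologicalSpace := by
  let _ := pseudoEMetricOfDist d h0 hs ht
  ext U
  rw [EMetric.isOpen_iff]
  refine forall₂_congr fun x _ => exists_congr fun ε => and_congr_right fun _ => ?_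
  exact forall_congr' fun y => by rw [Metric.mem_eball, edist_comm]; rfl

theorem isPrecompact_distTopology_iff {α : Type*} {d : α → α → ℝ≥0∞} (h0 : ∀ x, d x x = 0)
    (hs : ∀ x y, d x y = d y x) (ht : ∀ x y z, d x z ≤ d x y + d y z) {s : Set α} :
    IsPrecompact (distTopology d) s ↔ ∀ x : ℕ → α, (∀ n, x n ∈ s) →
      ∃ (a : α) (φ : ℕ → ℕ), StrictMono φ ∧ Tendsto (fun n => d (x (φ n)) a) atTop (𝓝 0) := by
  rw [distTopology_eq d h0 hs ht]
  let _ := pseudoEMetricOfDist d h0 hs ht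
  refine isCompact_closure_iff_subseq.trans ?_
  simp only [tendsto_iff_edist_tendsto_0]
  rfl

theorem exists_subseq_lt {f : ℕ → ℝ≥0∞} (hf : Tendsto f atTop (𝓝 0)) :
    ∃ φ : ℕ → ℕ, StrictMono φ ∧ ∀ n : ℕ, f (φ n) < ((n : ℝ≥0∞) + 1)⁻¹ := by
  exact extraction_forall_of_eventually (P := fun n k => f k < ((n : ℝ≥0∞) + 1)⁻¹) fun n =>
    hf.eventually_lt_const (ENNReal.inv_pos.2 (by finiteness))

/-! ## The local Hausdorff distance -/

section LocalHausdorff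

open Metric

variable {X : Type*} [MetricSpace X]

theorem localHausdorff_self (ρ : X) (A : Set X) : localHausdorff ρ A A = 0 := by
  simp [localHausdorff]

theorem localHausdorff_comm (ρ : X) (A B : Set X) :
    localHausdorff ρ A B = localHausdorff ρ B A := by
  simp [localHausdorff, hausdorffEDist_comm]

theorem localHausdorff_image {Y : Type*} [MetricSpace Y] {f : X → Y} (hf : Isometry f) (ρ : X)
    (A B : Set X) : localHausdorff (f ρ) (f '' A) (f '' B) = localHausdorff ρ A B := by
  have h : ∀ (C : Set X) (r : ℝ), f '' C ∩ closedBall (f ρ) r = f '' (C ∩ closedBall ρ r) := by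
    intro C r
    rw [← hf.preimage_closedBall ρ r, image_inter_preimage]
  simp only [localHausdorff, h, hausdorffEDist_image hf]

/-- For `c < c'` below the infimum, the points of `B` within `c'` of `a` form a compact set that
misses the closed ball of radius `r`. By compactness it also misses balls of slightly larger radius.
-/
theorem eventually_lt_infEDist_inter_closedBall [ProperSpace X] {ρ a : X} {B : Set X}
    (hB : IsClosed B) {r : ℝ} {c : ℝ≥0∞} (h : c < infEDist a (B ∩ closedBall ρ r)) :
    ∀ᶠ s in 𝓝 r, c < infEDist a (B ∩ closedBall ρ s) := by
  obtain ⟨c', hcc', hc'⟩ := exists_between h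
  have hc'top : c' ≠ ∞ := hc'.ne_top
  set K := B ∩ closedBall a c'.toReal with hK
  have hKc : IsCompact K := (isCompact_closedBall _ _).inter_left hB
  have hev : ∀ᶠ s in 𝓝 r, ∀ x ∈ K, s < dist x ρ := by
    have hopen : IsOpen {p : ℝ × X | p.1 < dist p.2 ρ} :=
      isOpen_lt continuous_fst (continuous_snd.dist continuous_const)
    refine hKc.eventually_forall_of_forall_eventually fun x hx => ?_
    refine hopen.mem_nhds ?_
    by_contra hcon
    simp only [mem_ofPred_eq, not_lt] at hcon
    have h1 : infEDist a (B ∩ closedBall ρ r) ≤ edist a x :=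
      infEDist_le_edist_of_mem ⟨hx.1, hcon⟩
    have h2 : edist a x ≤ c' := by
      rw [edist_dist, dist_comm]
      exact ENNReal.ofReal_le_of_le_toReal hx.2
    exact absurd (hc'.trans_le (h1.trans h2)) (lt_irrefl _)
  filter_upwards [hev] with s hs
  refine hcc'.trans_le (le_infEDist.2 fun x hx => ?_)
  by_contra hcon
  rw [not_le] at hcon
  refine absurd (hs x ⟨hx.1, ?_⟩) (not_lt.2 hx.2)
  rw [mem_closedBall, dist_comm, dist_edist]
  exact ENNReal.toReal_mono hc'top hcon.le

/-- Each superlevel set contains a right neighbourhood of each of its points, and such subsets of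
the line are measurable. A witness `a` in the ball of radius `r` stays in larger balls, and its
distance to the other set stays above `c` by the previous lemma. -/
theorem measurable_hausdorffEDist_inter_closedBall [ProperSpace X] (ρ : X) {A B : Set X}
    (hA : IsClosed A) (hB : IsClosed B) :
    Measurable fun r : ℝ => hausdorffEDist (A ∩ closedBall ρ r) (B ∩ closedBall ρ r) := by
  refine measurable_of_Ioi fun c => MeasurableSet.of_mem_nhdsGT fun r hr => ?_
  have key : ∀ {A B : Set X}, IsClosed B → c < ⨆ a ∈ A ∩ closedBall ρ r,
      infEDist a (B ∩ closedBall ρ r) → ∀ᶠ s in 𝓝[>] r,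
        c < ⨆ a ∈ A ∩ closedBall ρ s, infEDist a (B ∩ closedBall ρ s) := by
    intro A B hB h
    simp only [lt_iSup_iff] at h
    obtain ⟨a, ha, h⟩ := h
    filter_upwards [nhdsWithin_le_nhds (eventually_lt_infEDist_inter_closedBall hB h),
      self_mem_nhdsWithin] with s hs hrs
    simp only [lt_iSup_iff]
    exact ⟨a, ⟨ha.1, closedBall_subset_closedBall (le_of_lt hrs) ha.2⟩, hs⟩
  simp only [mem_preimage, mem_Ioi, hausdorffEDist_def, lt_sup_iff] at hr
  simp only [preimage, mem_Ioi, hausdorffEDist_def, lt_sup_iff]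
  rcases hr with hr | hr
  · exact (key hB hr).mono fun s hs => Or.inl hs
  · exact (key hA hr).mono fun s hs => Or.inr hs

theorem localHausdorff_triangle [ProperSpace X] (ρ : X) {A B : Set X} (C : Set X)
    (hA : IsClosed A) (hB : IsClosed B) :
    localHausdorff ρ A C ≤ localHausdorff ρ A B + localHausdorff ρ B C := by
  unfold localHausdorff
  -- Additivity needs only the first summand to be measurable, so `C` can be arbitrary.
  rw [← MeasureTheory.lintegral_add_left]
  · refine MeasureTheory.lintegral_mono fun r => ?_
    simp only
    rw [← mul_add]
    refine mul_le_mul_right ?_ _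
    refine (min_le_min_left 1 (hausdorffEDist_triangle (t := B ∩ closedBall ρ r))).trans ?_
    rcases le_total 1 (hausdorffEDist (A ∩ closedBall ρ r) (B ∩ closedBall ρ r)) with h | h
    · exact (min_le_left _ _).trans ((min_eq_left h).symm.le.trans le_self_add)
    rcases le_total 1 (hausdorffEDist (B ∩ closedBall ρ r) (C ∩ closedBall ρ r)) with h' | h'
    · exact (min_le_left _ _).trans ((min_eq_left h').symm.le.trans le_add_self)
    rw [min_eq_right h, min_eq_right h']
    exact min_le_right _ _
  · exact (ENNReal.measurable_ofReal.comp (Real.measurable_exp.comp measurable_neg)).mul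
      (measurable_const.min (measurable_hausdorffEDist_inter_closedBall ρ hA hB))

/-- A point `a` with no `ε`-close point in `B` forces the integrand to be at least `e^{-(R+1)} (1 ∧
ε)` for all radii in the interval from `R` to `R + 1`, which has length 1. -/
theorem exists_edist_lt_of_localHausdorff_lt {ρ : X} {A B : Set X} {R : ℝ} (hR : 0 ≤ R)
    {ε : ℝ≥0∞} (h : localHausdorff ρ A B < ENNReal.ofReal (Real.exp (-(R + 1))) * min 1 ε)
    {a : X} (ha : a ∈ A) (haR : dist a ρ ≤ R) : ∃ b ∈ B, edist a b < ε := by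
  by_contra! hcon
  refine absurd h (not_lt.2 ?_)
  calc ENNReal.ofReal (Real.exp (-(R + 1))) * min 1 ε
      = ∫⁻ _ in Ioo R (R + 1), ENNReal.ofReal (Real.exp (-(R + 1))) * min 1 ε := by simp
    _ ≤ ∫⁻ r in Ioo R (R + 1), ENNReal.ofReal (Real.exp (-r)) *
          min 1 (hausdorffEDist (A ∩ closedBall ρ r) (B ∩ closedBall ρ r)) := by
        refine MeasureTheory.setLIntegral_mono' measurableSet_Ioo fun r hr => ?_
        refine mul_le_mul' (ENNReal.ofReal_le_ofReal (Real.exp_le_exp.2 (by linarith [hr.2])))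
          (min_le_min_left 1 ?_)
        refine le_trans ?_ (infEDist_le_hausdorffEDist_of_mem
          (x := a) ⟨ha, haR.trans hr.1.le⟩)
        exact le_infEDist.2 fun b hb => hcon b hb.1
    _ ≤ localHausdorff ρ A B :=
        MeasureTheory.lintegral_mono_set fun r hr => lt_of_le_of_lt hR hr.1

end LocalHausdorff

/-! ## Amalgamation of a family of metric spaces along a common subspace -/

section Amalgam

variable {ι : Type} {Y : Type u} {W : ι → Type u} [∀ n, MetricSpace (W n)]

/-- The length of a shortest path from `w ∈ W n` to `w' ∈ W m` through `Y`. -/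
noncomputable def distThrough (i : ∀ n, Y → W n) {n m : ι} (w : W n) (w' : W m) : ℝ :=
  ⨅ y, (dist w (i n y) + dist (i m y) w')

theorem bddBelow_distThrough (i : ∀ n, Y → W n) {n m : ι} (w : W n) (w' : W m) :
    BddBelow (range fun y => dist w (i n y) + dist (i m y) w') :=
  ⟨0, by rintro _ ⟨y, rfl⟩; positivity⟩

theorem distThrough_le (i : ∀ n, Y → W n) {n m : ι} (w : W n) (w' : W m) (y : Y) :
    distThrough i w w' ≤ dist w (i n y) + dist (i m y) w' :=
  ciInf_le (bddBelow_distThrough i w w') y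

theorem distThrough_comm (i : ∀ n, Y → W n) {n m : ι} (w : W n) (w' : W m) :
    distThrough i w w' = distThrough i w' w := by
  unfold distThrough
  congr 1
  funext y
  rw [dist_comm w, dist_comm _ w', add_comm]

theorem dist_le_distThrough [Nonempty Y] (i : ∀ n, Y → W n) {n : ι} (w w' : W n) :
    dist w w' ≤ distThrough i w w' :=
  le_ciInf fun _ => dist_triangle _ _ _

theorem distThrough_le_dist_add [Nonempty Y] (i : ∀ n, Y → W n) {n m : ι} (w w' : W n) (w'' : W m) :
    distThrough i w w'' ≤ dist w w' + distThrough i w' w'' := by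
  rw [← sub_le_iff_le_add']
  refine le_ciInf fun y => ?_
  rw [sub_le_iff_le_add', ← add_assoc]
  exact (distThrough_le i w w'' y).trans (add_le_add_left (dist_triangle _ _ _) _)

theorem distThrough_triangle [MetricSpace Y] [Nonempty Y] {i : ∀ n, Y → W n} (hi : ∀ n, Isometry (i n)) {n m k : ι}
    (w : W n) (w' : W m) (w'' : W k) :
    distThrough i w w'' ≤ distThrough i w w' + distThrough i w' w'' := by
  refine le_ciInf_add_ciInf fun y z => ?_
  have h1 := distThrough_le i w w'' y
  have h2 : dist (i k y) w'' ≤ dist (i k y) (i k z) + dist (i k z) w'' := dist_triangle _ _ _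
  have h3 : dist (i m y) (i m z) ≤ dist (i m y) w' + dist w' (i m z) := dist_triangle _ _ _
  rw [(hi _).dist_eq] at h2 h3
  linarith

/-- The disjoint union of the spaces `W n`, to be glued along `Y`. -/
def PreAmalgam (_ : ∀ n, Y → W n) : Type u := Σ n, W n

open Classical in
/-- The pseudodistance on the disjoint union which glues the spaces `W n` along `Y`. -/
noncomputable def PreAmalgam.dist {i : ∀ n, Y → W n} (p q : PreAmalgam i) : ℝ :=
  if h : p.1 = q.1 then Dist.dist (h ▸ p.2) q.2 else distThrough i p.2 q.2

theorem PreAmalgam.dist_same {i : ∀ n, Y → W n} {n : ι} (w w' : W n) :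
    PreAmalgam.dist (i := i) ⟨n, w⟩ ⟨n, w'⟩ = Dist.dist w w' := by
  simp [PreAmalgam.dist]

theorem PreAmalgam.dist_of_ne {i : ∀ n, Y → W n} {n m : ι} (h : n ≠ m) (w : W n) (w' : W m) :
    PreAmalgam.dist (i := i) ⟨n, w⟩ ⟨m, w'⟩ = distThrough i w w' := by
  simp [PreAmalgam.dist, h]

theorem PreAmalgam.dist_le_distThrough [Nonempty Y] {i : ∀ n, Y → W n} {n m : ι} (w : W n) (w' : W m) :
    PreAmalgam.dist (i := i) ⟨n, w⟩ ⟨m, w'⟩ ≤ distThrough i w w' := by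
  rcases eq_or_ne n m with rfl | h
  · rw [PreAmalgam.dist_same]
    exact GHStruct.dist_le_distThrough i w w'
  · rw [PreAmalgam.dist_of_ne h]

theorem PreAmalgam.dist_comm {i : ∀ n, Y → W n} (p q : PreAmalgam i) :
    PreAmalgam.dist p q = PreAmalgam.dist q p := by
  obtain ⟨n, w⟩ := p
  obtain ⟨m, w'⟩ := q
  rcases eq_or_ne n m with rfl | h
  · rw [PreAmalgam.dist_same, PreAmalgam.dist_same, _root_.dist_comm]
  · rw [PreAmalgam.dist_of_ne h, PreAmalgam.dist_of_ne h.symm, distThrough_comm]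

theorem PreAmalgam.dist_triangle [MetricSpace Y] [Nonempty Y] {i : ∀ n, Y → W n}
    (hi : ∀ n, Isometry (i n))
    (p q r : PreAmalgam i) :
    PreAmalgam.dist p r ≤ PreAmalgam.dist p q + PreAmalgam.dist q r := by
  obtain ⟨n, w⟩ := p
  obtain ⟨m, w'⟩ := q
  obtain ⟨k, w''⟩ := r
  rcases eq_or_ne n m with rfl | hnm
  · rcases eq_or_ne n k with rfl | hnk
    · simp only [PreAmalgam.dist_same]
      exact _root_.dist_triangle _ _ _
    · rw [PreAmalgam.dist_same, PreAmalgam.dist_of_ne hnk, PreAmalgam.dist_of_ne hnk]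
      exact distThrough_le_dist_add i w w' w''
  · rw [PreAmalgam.dist_of_ne hnm]
    rcases eq_or_ne m k with rfl | hmk
    · rw [PreAmalgam.dist_same, PreAmalgam.dist_of_ne hnm, distThrough_comm i w,
        distThrough_comm i w, _root_.dist_comm, add_comm]
      exact distThrough_le_dist_add i w'' w' w
    · rw [PreAmalgam.dist_of_ne hmk]
      -- The indices `n` and `k` may coincide here: a detour through another piece is then at least
      -- as long as the distance inside `W n`.
      exact (PreAmalgam.dist_le_distThrough w w'').trans (distThrough_triangle hi w w' w'')

/-- The pseudometric on the disjoint union which glues the spaces `W n` along `Y`. -/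
noncomputable abbrev PreAmalgam.pseudoMetricSpace [MetricSpace Y] [Nonempty Y] {i : ∀ n, Y → W n}
    (hi : ∀ n, Isometry (i n)) : PseudoMetricSpace (PreAmalgam i) where
  dist := PreAmalgam.dist
  dist_self p := (PreAmalgam.dist_same p.2 p.2).trans (dist_self _)
  dist_comm := PreAmalgam.dist_comm
  dist_triangle := PreAmalgam.dist_triangle hi

theorem exists_metric_amalgam [MetricSpace Y] [Nonempty Y] {i : ∀ n, Y → W n}
    (hi : ∀ n, Isometry (i n)) :
    ∃ (V : Type u) (_ : MetricSpace V) (l : ∀ n, W n → V), (∀ n, Isometry (l n)) ∧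
      (∀ n m y, l n (i n y) = l m (i m y)) ∧ ∀ v, ∃ n w, l n w = v := by
  let _ := PreAmalgam.pseudoMetricSpace hi
  let l : ∀ n, W n → SeparationQuotient (PreAmalgam i) :=
    fun n w => SeparationQuotient.mk (⟨n, w⟩ : PreAmalgam i)
  have hl : ∀ n m (w : W n) (w' : W m),
      dist (l n w) (l m w') = PreAmalgam.dist (i := i) ⟨n, w⟩ ⟨m, w'⟩ := fun n m w w' =>
    SeparationQuotient.dist_mk _ _
  refine ⟨SeparationQuotient (PreAmalgam i), inferInstance, l, fun n => ?_, fun n m y => ?_, ?_⟩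
  · exact Isometry.of_dist_eq fun w w' => (hl n n w w').trans (PreAmalgam.dist_same w w')
  · refine dist_le_zero.1 ?_
    rw [hl]
    refine (PreAmalgam.dist_le_distThrough _ _).trans ((distThrough_le i _ _ y).trans ?_)
    simp
  · intro v
    obtain ⟨⟨n, w⟩, rfl⟩ := SeparationQuotient.surjective_mk v
    exact ⟨n, w, rfl⟩

end Amalgam

/-- An ultrafilter on a ball either contains one of the pieces, where properness of that piece gives
a limit, or avoids every finite union of pieces. In the second case the nearest-point projection `π`
to `Y` moves points by arbitrarily little along the ultrafilter, so a limit of the projections,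
which exists by properness of `Y`, is a limit of the ultrafilter. -/
theorem properSpace_of_family {ι : Type*} {V Y : Type*} {W : ι → Type*} [MetricSpace V]
    [MetricSpace Y] [ProperSpace Y] [∀ n, MetricSpace (W n)] [∀ n, ProperSpace (W n)]
    {j : Y → V} (hj : Isometry j) {l : ∀ n, W n → V} (hl : ∀ n, Isometry (l n))
    (hcover : ∀ v, ∃ n w, l n w = v) (ρ : Y) (hρ : ∀ n, j ρ ∈ range (l n))
    (hnear : ∀ R ε : ℝ, 0 < ε → ∀ᶠ n in cofinite, ∀ w : W n, dist (l n w) (j ρ) ≤ R →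
      ∃ y, dist (l n w) (j y) ≤ ε) : ProperSpace V := by
  have : Nonempty Y := ⟨ρ⟩
  -- The distance from `v` to points of the proper space `Y` tends to infinity at infinity, hence
  -- attains its minimum.
  have hmin : ∀ v, ∃ y, ∀ z, dist v (j y) ≤ dist v (j z) := by
    intro v
    refine (continuous_const.dist hj.continuous).exists_forall_le ?_
    refine tendsto_atTop_mono (f := fun z => dist ρ z - dist v (j ρ)) (fun z => ?_) ?_
    · rw [sub_le_iff_le_add', ← hj.dist_eq, dist_comm v (j ρ)]
      exact dist_triangle _ _ _
    · exact tendsto_atTop_add_const_right _ _ (tendsto_dist_right_cocompact_atTop ρ |>.congr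
        fun z => dist_comm _ _)
  choose π hπ using hmin
  refine ProperSpace.of_seq_closedBall (x := j ρ) (r := fun n : ℕ => (n : ℝ)) (l := atTop)
    tendsto_natCast_atTop_atTop (Eventually.of_forall fun N => ?_)
  refine isCompact_iff_ultrafilter_le_nhds.2 fun 𝒰 h𝒰 => ?_
  have hball : Metric.closedBall (j ρ) N ∈ 𝒰 := le_principal_iff.1 h𝒰
  have hcl : ∀ x, (𝒰 : Filter V) ≤ 𝓝 x → x ∈ Metric.closedBall (j ρ) (N : ℝ) := fun x hx =>
    Metric.isClosed_closedBall.mem_of_tendsto hx hball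
  by_cases hcase : ∃ n, range (l n) ∈ 𝒰
  · obtain ⟨n, hn⟩ := hcase
    obtain ⟨w₀, hw₀⟩ := hρ n
    have hc : IsCompact (l n '' Metric.closedBall w₀ N) :=
      (isCompact_closedBall _ _).image (hl n).continuous
    have hmem : l n '' Metric.closedBall w₀ N ∈ 𝒰 := by
      filter_upwards [hn, hball] with v hv hvb
      obtain ⟨w, rfl⟩ := hv
      refine ⟨w, ?_, rfl⟩
      rwa [Metric.mem_closedBall, ← hw₀, (hl n).dist_eq] at hvb
    obtain ⟨x, -, hx⟩ := hc.ultrafilter_le_nhds 𝒰 (le_principal_iff.2 hmem)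
    exact ⟨x, hcl x hx, hx⟩
  · push Not at hcase
    -- The projection is no farther from `v` than the root is, hence at most `2 * N` from the root.
    have hπball : ∀ᶠ v in (𝒰 : Filter V), π v ∈ Metric.closedBall ρ (2 * N : ℝ) := by
      filter_upwards [hball] with v hv
      rw [Metric.mem_closedBall] at hv ⊢
      have h1 := hπ v ρ
      have h2 := dist_triangle_left (j (π v)) (j ρ) v
      rw [← hj.dist_eq]
      linarith
    obtain ⟨y, -, hy⟩ := (isCompact_closedBall ρ (2 * N : ℝ)).ultrafilter_le_nhds
      (𝒰.map π) (le_principal_iff.2 hπball)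
    have hnear0 : Tendsto (fun v => dist (j (π v)) v) 𝒰 (𝓝 0) := by
      rw [Metric.tendsto_nhds]
      intro ε hε
      have hfin := hnear N (ε / 2) (half_pos hε)
      rw [eventually_cofinite] at hfin
      -- Only finitely many pieces fail to be `ε / 2`-close to `Y` on this ball, and the ultrafilter
      -- avoids all of them.
      have hcompl : ∀ᶠ v in (𝒰 : Filter V), ∀ n ∈ {n | ¬ ∀ w : W n, dist (l n w) (j ρ) ≤ N →
          ∃ y, dist (l n w) (j y) ≤ ε / 2}, v ∉ range (l n) :=
        (eventually_all_finite hfin).2 fun n _ => Ultrafilter.compl_mem_iff_notMem.2 (hcase n)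
      filter_upwards [hcompl, hball] with v hv hvb
      obtain ⟨n, w, rfl⟩ := hcover v
      have hgood : ∀ w : W n, dist (l n w) (j ρ) ≤ N → ∃ y, dist (l n w) (j y) ≤ ε / 2 := by
        by_contra hbad
        exact hv n hbad ⟨w, rfl⟩
      obtain ⟨z, hz⟩ := hgood w hvb
      rw [Real.dist_eq, sub_zero, abs_of_nonneg dist_nonneg, dist_comm]
      linarith [hπ (l n w) z]
    have hlim : Tendsto (fun v : V => v) 𝒰 (𝓝 (j y)) :=
      (tendsto_iff_of_dist hnear0).1 ((hj.continuous.tendsto y).comp hy)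
    exact ⟨j y, hcl _ hlim, hlim⟩

/-- Rooted bcm spaces containing a common subspace `Y` can be embedded into a common rooted bcm
space, compatibly on `Y`, if all but finitely many of them are locally close to `Y`. -/
theorem RBCM.exists_amalgam {ι : Type} [Nonempty ι] {Y : RBCM.{u}} {W : ι → RBCM.{u}}
    (i : ∀ n, Y ⟶ W n)
    (hnear : ∀ R ε : ℝ, 0 < ε → ∀ᶠ n in cofinite, ∀ w : (W n).space, dist w (W n).root ≤ R →
      ∃ y, dist w ((i n).toHom.toFun y) ≤ ε) :
    ∃ (V : RBCM.{u}) (j : Y ⟶ V) (l : ∀ n, W n ⟶ V), ∀ n, i n ≫ l n = j := by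
  obtain ⟨V, _, l, hl, hcomm, hcover⟩ := exists_metric_amalgam
    (i := fun n => (i n).toHom.toFun) fun n => (i n).toHom.isometry
  obtain ⟨n₀⟩ := ‹Nonempty ι›
  have hj : Isometry (l n₀ ∘ (i n₀).toHom.toFun) := (hl n₀).comp (i n₀).toHom.isometry
  have hroot : ∀ n, l n (W n).root = (l n₀ ∘ (i n₀).toHom.toFun) Y.root := fun n => by
    rw [← (i n).map_root]
    exact hcomm n n₀ _
  have : ProperSpace V := by
    refine properSpace_of_family hj hl hcover Y.root (fun n => ⟨_, hroot n⟩) fun R ε hε => ?_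
    filter_upwards [hnear R ε hε] with n hn w hw
    rw [← hroot n, (hl n).dist_eq] at hw
    obtain ⟨y, hy⟩ := hn w hw
    refine ⟨y, ?_⟩
    rwa [Function.comp_apply, ← hcomm n n₀ y, (hl n).dist_eq]
  have : Nonempty V := ⟨(l n₀ ∘ (i n₀).toHom.toFun) Y.root⟩
  refine ⟨⟨⟨V⟩, (l n₀ ∘ (i n₀).toHom.toFun) Y.root⟩, ⟨⟨_, hj⟩, rfl⟩,
    fun n => ⟨⟨l n, hl n⟩, hroot n⟩, fun n => ?_⟩
  apply RBCM.Hom.ext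
  apply BCM.Hom.ext
  funext y
  exact hcomm n n₀ y

theorem RBCM.exists_pushout {Y Z Z' : RBCM.{u}} (g : Y ⟶ Z) (g' : Y ⟶ Z') :
    ∃ (V : RBCM.{u}) (l : Z ⟶ V) (l' : Z' ⟶ V), g ≫ l = g' ≫ l' := by
  obtain ⟨V, j, l, hl⟩ := RBCM.exists_amalgam (ι := Bool) (Y := Y)
    (W := fun b => Bool.rec Z Z' b) (fun b => Bool.rec g g' b) fun R ε _ => by
      -- With two pieces the closeness condition is void, since it exempts finitely many indices.
      rw [cofinite_eq_bot]
      exact eventually_bot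
  exact ⟨V, l false, l true, (hl false).trans (hl true).symm⟩

/-- Two subspaces of a rooted bcm space are contained in the subspace which is their union. -/
theorem RBCM.exists_union {X Y Z : RBCM.{u}} (f : X ⟶ Z) (g : Y ⟶ Z) :
    ∃ (W : RBCM.{u}) (f' : X ⟶ W) (g' : Y ⟶ W) (e : W ⟶ Z), f' ≫ e = f ∧ g' ≫ e = g ∧
      ∀ w : W.space, w ∈ range f'.toHom.toFun ∨ w ∈ range g'.toHom.toFun := by
  have hclosed : IsClosed (range f.toHom.toFun ∪ range g.toHom.toFun) :=
    f.toHom.isometry.isClosedEmbedding.isClosed_range.union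
      g.toHom.isometry.isClosedEmbedding.isClosed_range
  set S : Set Z.space := range f.toHom.toFun ∪ range g.toHom.toFun with hS
  have : ProperSpace S := ProperSpace.of_isClosed hclosed
  have hρ : Z.root ∈ S := Or.inl ⟨X.root, f.map_root⟩
  have : Nonempty S := ⟨⟨_, hρ⟩⟩
  refine ⟨⟨⟨S⟩, ⟨Z.root, hρ⟩⟩,
    ⟨⟨fun x => ⟨f.toHom.toFun x, Or.inl ⟨x, rfl⟩⟩, Isometry.of_dist_eq f.toHom.isometry.dist_eq⟩,
      Subtype.ext f.map_root⟩,
    ⟨⟨fun x => ⟨g.toHom.toFun x, Or.inr ⟨x, rfl⟩⟩, Isometry.of_dist_eq g.toHom.isometry.dist_eq⟩,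
      Subtype.ext g.map_root⟩,
    ⟨⟨Subtype.val, isometry_subtype_coe⟩, rfl⟩, rfl, rfl, ?_⟩
  rintro ⟨w, ⟨x, rfl⟩ | ⟨x, rfl⟩⟩
  · exact Or.inl ⟨x, rfl⟩
  · exact Or.inr ⟨x, rfl⟩

/-! ## Consequences of local Hausdorff convergence -/

theorem localHausdorff_range_comp {X Y Z W : RBCM.{u}} (f : X ⟶ Z) (g : Y ⟶ Z) (e : Z ⟶ W) :
    localHausdorff W.root (range (f ≫ e).toHom.toFun) (range (g ≫ e).toHom.toFun) =
      localHausdorff Z.root (range f.toHom.toFun) (range g.toHom.toFun) := by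
  rw [← localHausdorff_image e.toHom.isometry, ← range_comp, ← range_comp, e.map_root]
  rfl

theorem eventually_exists_dist_lt {Z : ℕ → RBCM.{u}} {A B : ∀ n, Set (Z n).space}
    (h : Tendsto (fun n => localHausdorff (Z n).root (A n) (B n)) atTop (𝓝 0)) (R : ℝ) {ε : ℝ}
    (hε : 0 < ε) :
    ∀ᶠ n in atTop, ∀ a ∈ A n, dist a (Z n).root ≤ R → ∃ b ∈ B n, dist a b < ε := by
  -- The radius is replaced by `max R 0` because `R` may be negative.
  have hpos : 0 < ENNReal.ofReal (Real.exp (-(max R 0 + 1))) * min 1 (ENNReal.ofReal ε) :=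
    ENNReal.mul_pos (by simp [Real.exp_pos]) (by simp [hε])
  filter_upwards [h.eventually_lt_const hpos] with n hn a ha haR
  obtain ⟨b, hb, hab⟩ := exists_edist_lt_of_localHausdorff_lt (le_max_right R 0) hn ha
    (haR.trans (le_max_left _ _))
  exact ⟨b, hb, edist_lt_ofReal.1 hab⟩

/-- Tested on the subbasis. A compact `K` disjoint from the limit has a `δ`-thickening disjoint from
a `δ`-thickening of the limit, and `K` lies in one ball. For an open `G`, it suffices to approximate
a single point of the limit in `G`. -/
theorem tendsto_fellTopology {V : RBCM.{u}} {X : ℕ → RBCM.{u}} {Y : RBCM.{u}}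
    (k : ∀ n, X n ⟶ V) (j : Y ⟶ V)
    (h : Tendsto (fun n => localHausdorff V.root (range (k n).toHom.toFun)
      (range j.toHom.toFun)) atTop (𝓝 0)) :
    Tendsto (fun n => BCM.Hom.image (k n).toHom) atTop
      (@nhds _ (fellTopology V.space) (BCM.Hom.image j.toHom)) := by
  rw [TopologicalSpace.tendsto_nhds_generateFrom_iff]
  rintro _ (⟨K, hK, rfl⟩ | ⟨G, hG, rfl⟩) hmem
  · have hdisj : Disjoint K (range j.toHom.toFun) := by
      rw [disjoint_comm, disjoint_iff_inter_eq_empty]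
      exact hmem
    obtain ⟨δ, hδ, hthick⟩ := hdisj.exists_thickenings hK
      j.toHom.isometry.isClosedEmbedding.isClosed_range
    obtain ⟨R, hR⟩ := hK.isBounded.subset_closedBall V.root
    filter_upwards [eventually_exists_dist_lt (Z := fun _ => V) h R hδ] with n hn
    refine eq_empty_iff_forall_notMem.2 fun x hx => ?_
    obtain ⟨b, hb, hxb⟩ := hn x hx.1 (hR hx.2)
    exact disjoint_left.1 hthick (Metric.self_subset_thickening hδ K hx.2)
      (Metric.mem_thickening_iff.2 ⟨b, hb, hxb⟩)
  · obtain ⟨p, hp, hpG⟩ := hmem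
    obtain ⟨ε, hε, hball⟩ := Metric.isOpen_iff.1 hG p hpG
    have h' : Tendsto (fun n => localHausdorff V.root (range j.toHom.toFun)
        (range (k n).toHom.toFun)) atTop (𝓝 0) :=
      h.congr fun n => localHausdorff_comm _ _ _
    filter_upwards [eventually_exists_dist_lt (Z := fun _ => V) h' (dist p V.root) hε] with n hn
    obtain ⟨b, hb, hpb⟩ := hn p hp le_rfl
    exact ⟨b, hb, hball (by rwa [Metric.mem_ball, dist_comm])⟩

/-- Spaces which are close to `X` in `W n` can be embedded into a common space together with `X`. -/
theorem RBCM.exists_common_space {X : RBCM.{u}} {X' Z : ℕ → RBCM.{u}} (f : ∀ n, X' n ⟶ Z n)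
    (g : ∀ n, X ⟶ Z n)
    (hnear : ∀ R ε : ℝ, 0 < ε → ∀ᶠ n in atTop, ∀ x, dist ((f n).toHom.toFun x) (Z n).root ≤ R →
      ∃ y, dist ((f n).toHom.toFun x) ((g n).toHom.toFun y) ≤ ε) :
    ∃ (V : RBCM.{u}) (j : X ⟶ V) (k : ∀ n, X' n ⟶ V), ∀ n, ∃ (W : RBCM.{u}) (f' : X' n ⟶ W)
      (g' : X ⟶ W) (e : W ⟶ Z n) (l : W ⟶ V),
      f' ≫ e = f n ∧ g' ≫ e = g n ∧ f' ≫ l = k n ∧ g' ≫ l = j := by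
  -- Each `Z n` is cut down to the union of the two images. The rest of `Z n` need not be close to
  -- `X` and would spoil the amalgam.
  choose W f' g' e hf hg hcover using fun n => RBCM.exists_union (f n) (g n)
  obtain ⟨V, j, l, hl⟩ := RBCM.exists_amalgam g' fun R ε hε => by
    rw [Nat.cofinite_eq_atTop]
    filter_upwards [hnear R ε hε] with n hn w hw
    rcases hcover n w with ⟨x, rfl⟩ | ⟨y, rfl⟩
    · have he := (e n).toHom.isometry
      have hfx : ∀ x, (f n).toHom.toFun x = (e n).toHom.toFun ((f' n).toHom.toFun x) := fun x => by
        rw [← hf n]; rfl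
      have hgy : ∀ y, (g n).toHom.toFun y = (e n).toHom.toFun ((g' n).toHom.toFun y) := fun y => by
        rw [← hg n]; rfl
      obtain ⟨y, hy⟩ := hn x (by rwa [hfx, ← (e n).map_root, he.dist_eq])
      exact ⟨y, by rwa [hfx, hgy, he.dist_eq] at hy⟩
    · exact ⟨y, by simpa using hε.le⟩
  exact ⟨V, j, fun n => f' n ≫ l n, fun n => ⟨W n, f' n, g' n, e n, l n, hf n, hg n, rfl, hl n⟩⟩

/-! ## Compactness of the set of embeddings -/

/-- Arzelà–Ascoli: rooted isometric embeddings are 1-Lipschitz, send `x` into the compact ball of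
radius `dist x X.root` about the root, and are cut out by pointwise closed conditions. -/
theorem RBCM.exists_subseq_tendstoUniformlyOn {X V : RBCM.{u}} (h : ℕ → (X ⟶ V)) :
    ∃ (H : X ⟶ V) (φ : ℕ → ℕ), StrictMono φ ∧ ∀ K : Set X.space, IsCompact K →
      TendstoUniformlyOn (fun n => (h (φ n)).toHom.toFun) H.toHom.toFun atTop K := by
  let S : Set C(X.space, V.space) := {F | Isometry F ∧ F X.root = V.root}
  have himage : ContinuousMap.toFun '' S = {F | Isometry F ∧ F X.root = V.root} := by
    ext F
    constructor
    · rintro ⟨G, hG, rfl⟩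
      exact hG
    · intro hF
      exact ⟨⟨F, hF.1.continuous⟩, hF, rfl⟩
  have hpt : IsCompact {F : X.space → V.space | Isometry F ∧ F X.root = V.root} := by
    refine (isCompact_univ_pi fun x => isCompact_closedBall V.root (dist x X.root)).of_isClosed_subset
      ?_ ?_
    · have : {F : X.space → V.space | Isometry F ∧ F X.root = V.root} =
          (⋂ x, ⋂ y, {F | dist (F x) (F y) = dist x y}) ∩ {F | F X.root = V.root} := by
        ext F
        simp [isometry_iff_dist_eq]
      rw [this]
      refine IsClosed.inter (isClosed_iInter fun x => isClosed_iInter fun y => ?_) ?_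
      · exact isClosed_eq ((continuous_apply x).dist (continuous_apply y)) continuous_const
      · exact isClosed_eq (continuous_apply _) continuous_const
    · rintro F ⟨hF, hroot⟩ x -
      simp only [Metric.mem_closedBall]
      rw [← hroot, hF.dist_eq]
  have hS : IsCompact S := by
    refine ArzelaAscoli.isCompact_of_equicontinuous S (himage ▸ hpt) ?_
    refine (LipschitzWith.uniformEquicontinuous _ 1 fun F : S => ?_).equicontinuous
    exact F.2.1.lipschitz
  obtain ⟨H, hH, φ, hφ, hlim⟩ := hS.isSeqCompact
    (x := fun n => (⟨(h n).toHom.toFun, (h n).toHom.isometry.continuous⟩ : C(X.space, V.space)))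
    fun n => ⟨(h n).toHom.isometry, (h n).map_root⟩
  exact ⟨⟨⟨H, hH.1⟩, hH.2⟩, φ, hφ,
    ContinuousMap.tendsto_iff_forall_isCompact_tendstoUniformlyOn.1 hlim⟩

/-! ## Space-rooted metrizations -/

section Metrization

variable {τ : Structure.{u, v}} (σ : SpaceRootedMetrization τ)

/-- The distance on `τ(X)` with values in `ℝ≥0∞`. -/
noncomputable def SpaceRootedMetrization.edist (X : RBCM.{u}) (a b : τ.rooted.obj X) : ℝ≥0∞ :=
  ENNReal.ofReal ((σ.metric X).dist a b)

namespace SpaceRootedMetrization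

theorem edist_eq (X : RBCM.{u}) (a b : τ.rooted.obj X) :
    σ.edist X a b = (σ.metric X).toPseudoMetricSpace.toPseudoEMetricSpace.edist a b :=
  ((σ.metric X).edist_dist a b).symm

theorem edist_self (X : RBCM.{u}) (a : τ.rooted.obj X) : σ.edist X a a = 0 := by
  let _ := σ.metric X
  rw [edist_eq]
  exact PseudoEMetricSpace.edist_self a

theorem edist_comm (X : RBCM.{u}) (a b : τ.rooted.obj X) : σ.edist X a b = σ.edist X b a := by
  let _ := σ.metric X
  rw [edist_eq, edist_eq]
  exact PseudoEMetricSpace.edist_comm a b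

theorem edist_triangle (X : RBCM.{u}) (a b c : τ.rooted.obj X) :
    σ.edist X a c ≤ σ.edist X a b + σ.edist X b c := by
  let _ := σ.metric X
  simp only [edist_eq]
  exact PseudoEMetricSpace.edist_triangle a b c

theorem edist_map {X Y : RBCM.{u}} (f : X ⟶ Y) (a b : τ.rooted.obj X) :
    σ.edist Y ((τ.rooted.map f).toFun a) ((τ.rooted.map f).toFun b) = σ.edist X a b := by
  rw [edist, edist, σ.dist_map]

theorem tendsto_iff (X : RBCM.{u}) {x : ℕ → τ.rooted.obj X} {a : τ.rooted.obj X} :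
    Tendsto x atTop (𝓝 a) ↔ Tendsto (fun n => σ.edist X (x n) a) atTop (𝓝 0) := by
  rw [← σ.topology_eq X]
  let _ := σ.metric X
  simp only [edist_eq]
  exact tendsto_iff_edist_tendsto_0

theorem isPrecompact_iff (X : RBCM.{u}) {s : Set (τ.rooted.obj X)} :
    GHStruct.IsPrecompact inferInstance s ↔ ∀ x : ℕ → τ.rooted.obj X, (∀ n, x n ∈ s) →
      ∃ (a : τ.rooted.obj X) (φ : ℕ → ℕ), StrictMono φ ∧
        Tendsto (fun n => σ.edist X (x (φ n)) a) atTop (𝓝 0) := by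
  change GHStruct.IsPrecompact (τ.rooted.obj X).topologicalSpace s ↔ _
  rw [← σ.topology_eq X]
  let _ := σ.metric X
  refine isCompact_closure_iff_subseq.trans ?_
  simp only [edist_eq, tendsto_iff_edist_tendsto_0]

end SpaceRootedMetrization

theorem Structure.map_comp_apply (τ : Structure.{u, v}) {X Y Z : RBCM.{u}} (f : X ⟶ Y) (g : Y ⟶ Z)
    (a : τ.rooted.obj X) :
    (τ.rooted.map (f ≫ g)).toFun a = (τ.rooted.map g).toFun ((τ.rooted.map f).toFun a) :=
  congrArg (fun h => MTop.Hom.toFun h a) (τ.rooted.map_comp f g)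

theorem SpaceRootedMetrization.edist_map_comp {X Y Z W : RBCM.{u}} (f : X ⟶ Z) (g : Y ⟶ Z)
    (e : Z ⟶ W) (a : τ.rooted.obj X) (b : τ.rooted.obj Y) :
    σ.edist W ((τ.rooted.map (f ≫ e)).toFun a) ((τ.rooted.map (g ≫ e)).toFun b) =
      σ.edist Z ((τ.rooted.map f).toFun a) ((τ.rooted.map g).toFun b) := by
  rw [Structure.map_comp_apply, Structure.map_comp_apply, σ.edist_map]

end Metrization

/-! ## The Gromov--Hausdorff-type distances are pseudometrics -/

theorem RBCM.ghDist_lt_iff {X Y : RBCM.{u}} {c : ℝ≥0∞} :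
    RBCM.ghDist X Y < c ↔ ∃ (Z : RBCM.{u}) (f : X ⟶ Z) (g : Y ⟶ Z),
      localHausdorff Z.root (range f.toHom.toFun) (range g.toHom.toFun) < c := by
  simp only [RBCM.ghDist, iInf_lt_iff]

theorem RBCM.ghDist_self (X : RBCM.{u}) : RBCM.ghDist X X = 0 :=
  le_antisymm (iInf_le_of_le X (iInf_le_of_le (𝟙 X) (iInf_le_of_le (𝟙 X)
    (localHausdorff_self _ _).le))) zero_le

theorem RBCM.ghDist_comm (X Y : RBCM.{u}) : RBCM.ghDist X Y = RBCM.ghDist Y X := by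
  simp only [RBCM.ghDist]
  refine iInf_congr fun Z => ?_
  rw [iInf_comm]
  simp only [localHausdorff_comm]

theorem localHausdorff_range_triangle {X Y Z W W' V : RBCM.{u}} (f : X ⟶ W) (g : Y ⟶ W)
    (g' : Y ⟶ W') (h : Z ⟶ W') (l : W ⟶ V) (l' : W' ⟶ V) (hl : g ≫ l = g' ≫ l') :
    localHausdorff V.root (range (f ≫ l).toHom.toFun) (range (h ≫ l').toHom.toFun) ≤
      localHausdorff W.root (range f.toHom.toFun) (range g.toHom.toFun) +
        localHausdorff W'.root (range g'.toHom.toFun) (range h.toHom.toFun) := by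
  rw [← localHausdorff_range_comp f g l, ← localHausdorff_range_comp g' h l', ← hl]
  exact localHausdorff_triangle _ _ (f ≫ l).toHom.isometry.isClosedEmbedding.isClosed_range
    (g ≫ l).toHom.isometry.isClosedEmbedding.isClosed_range

/-- A coupling of `X` with `Y` and one of `Y` with `Z` are glued along `Y`. The triangle inequality
is then that of the local Hausdorff distance in the glued space. -/
theorem RBCM.ghDist_triangle (X Y Z : RBCM.{u}) :
    RBCM.ghDist X Z ≤ RBCM.ghDist X Y + RBCM.ghDist Y Z := by
  refine le_of_forall_gt fun c hc => ?_
  obtain ⟨c₁, h₁, c₂, h₂, hcc⟩ := ENNReal.exists_add_lt_of_add_lt hc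
  obtain ⟨W, f, g, hfg⟩ := RBCM.ghDist_lt_iff.1 h₁
  obtain ⟨W', g', h, hgh⟩ := RBCM.ghDist_lt_iff.1 h₂
  obtain ⟨V, l, l', hl⟩ := RBCM.exists_pushout g g'
  exact RBCM.ghDist_lt_iff.2 ⟨V, f ≫ l, h ≫ l',
    (localHausdorff_range_triangle f g g' h l l' hl).trans_lt ((ENNReal.add_lt_add hfg hgh).trans hcc)⟩

theorem RootedGH.dist_self (p : RootedGH.{u}) : RootedGH.dist p p = 0 :=
  Quotient.inductionOn p RBCM.ghDist_self

theorem RootedGH.dist_comm (p q : RootedGH.{u}) : RootedGH.dist p q = RootedGH.dist q p :=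
  Quotient.inductionOn₂ p q RBCM.ghDist_comm

theorem RootedGH.dist_triangle (p q r : RootedGH.{u}) :
    RootedGH.dist p r ≤ RootedGH.dist p q + RootedGH.dist q r :=
  Quotient.inductionOn₃ p q r RBCM.ghDist_triangle

section Triple

variable {τ : Structure.{u, v}} (σ : SpaceRootedMetrization τ)

theorem Triple.ghDist_lt_iff {𝒳 𝒴 : Triple τ} {c : ℝ≥0∞} :
    Triple.ghDist σ 𝒳 𝒴 < c ↔ ∃ (Z : RBCM.{u}) (f : 𝒳.base ⟶ Z) (g : 𝒴.base ⟶ Z),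
      localHausdorff Z.root (range f.toHom.toFun) (range g.toHom.toFun) < c ∧
        σ.edist Z ((τ.rooted.map f).toFun 𝒳.elem) ((τ.rooted.map g).toFun 𝒴.elem) < c := by
  simp only [Triple.ghDist, iInf_lt_iff, max_lt_iff]
  rfl

theorem Triple.ghDist_le_max {𝒳 𝒴 : Triple τ} {Z : RBCM.{u}} (f : 𝒳.base ⟶ Z) (g : 𝒴.base ⟶ Z) :
    Triple.ghDist σ 𝒳 𝒴 ≤
      max (localHausdorff Z.root (range f.toHom.toFun) (range g.toHom.toFun))
        (σ.edist Z ((τ.rooted.map f).toFun 𝒳.elem) ((τ.rooted.map g).toFun 𝒴.elem)) :=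
  iInf_le_of_le Z (iInf_le_of_le f (iInf_le _ g))

theorem Triple.ghDist_self (𝒳 : Triple τ) : Triple.ghDist σ 𝒳 𝒳 = 0 := by
  refine le_antisymm ((Triple.ghDist_le_max σ (𝟙 _) (𝟙 _)).trans ?_) zero_le
  rw [localHausdorff_self, σ.edist_self, max_self]

theorem Triple.ghDist_comm (𝒳 𝒴 : Triple τ) : Triple.ghDist σ 𝒳 𝒴 = Triple.ghDist σ 𝒴 𝒳 := by
  refine le_antisymm (le_of_forall_gt fun c hc => ?_) (le_of_forall_gt fun c hc => ?_) <;>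
  · obtain ⟨Z, f, g, h, h'⟩ := (Triple.ghDist_lt_iff σ).1 hc
    rw [localHausdorff_comm] at h
    rw [σ.edist_comm] at h'
    exact (Triple.ghDist_lt_iff σ).2 ⟨Z, g, f, h, h'⟩

theorem Triple.ghDist_triangle (𝒳 𝒴 𝒵 : Triple τ) :
    Triple.ghDist σ 𝒳 𝒵 ≤ Triple.ghDist σ 𝒳 𝒴 + Triple.ghDist σ 𝒴 𝒵 := by
  refine le_of_forall_gt fun c hc => ?_
  obtain ⟨c₁, h₁, c₂, h₂, hcc⟩ := ENNReal.exists_add_lt_of_add_lt hc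
  obtain ⟨W, f, g, hfg, hfg'⟩ := (Triple.ghDist_lt_iff σ).1 h₁
  obtain ⟨W', g', h, hgh, hgh'⟩ := (Triple.ghDist_lt_iff σ).1 h₂
  obtain ⟨V, l, l', hl⟩ := RBCM.exists_pushout g g'
  refine (Triple.ghDist_lt_iff σ).2 ⟨V, f ≫ l, h ≫ l',
    (localHausdorff_range_triangle f g g' h l l' hl).trans_lt ((ENNReal.add_lt_add hfg hgh).trans hcc),
    (σ.edist_triangle V _ ((τ.rooted.map (g ≫ l)).toFun 𝒴.elem) _).trans_lt ?_⟩
  refine lt_trans (ENNReal.add_lt_add (lt_of_eq_of_lt (σ.edist_map_comp f g l _ _) hfg') ?_) hcc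
  rw [hl]
  exact lt_of_eq_of_lt (σ.edist_map_comp g' h l' _ _) hgh'

theorem GHSpace.dist_self (p : GHSpace τ) : GHSpace.dist σ p p = 0 :=
  Quotient.inductionOn p (Triple.ghDist_self σ)

theorem GHSpace.dist_comm (p q : GHSpace τ) : GHSpace.dist σ p q = GHSpace.dist σ q p :=
  Quotient.inductionOn₂ p q (Triple.ghDist_comm σ)

theorem GHSpace.dist_triangle (p q r : GHSpace τ) :
    GHSpace.dist σ p r ≤ GHSpace.dist σ p q + GHSpace.dist σ q r :=
  Quotient.inductionOn₃ p q r (Triple.ghDist_triangle σ)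

theorem GHSpace.dist_toRooted_le (p q : GHSpace τ) :
    RootedGH.dist p.toRooted q.toRooted ≤ GHSpace.dist σ p q :=
  Quotient.inductionOn₂ p q fun _ _ =>
    iInf_mono fun _ => iInf_mono fun _ => iInf_mono fun _ => le_max_left _ _

end Triple

/-! ## Precompact sets of triples -/

variable {τ : Structure.{u, v}} (σ : SpaceRootedMetrization τ)

theorem RBCM.dist_comp_comp {X Y W Z : RBCM.{u}} (f : X ⟶ W) (g : Y ⟶ W) (e : W ⟶ Z) (x : X.space)
    (y : Y.space) : dist ((f ≫ e).toHom.toFun x) ((g ≫ e).toHom.toFun y) =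
      dist (f.toHom.toFun x) (g.toHom.toFun y) :=
  e.toHom.isometry.dist_eq _ _

/-- An embedding whose image lies in the image of `j` factors through `j`. -/
theorem RBCM.exists_factor {X Y V : RBCM.{u}} (j : Y ⟶ V) (h : X ⟶ V)
    (hr : ∀ x, h.toHom.toFun x ∈ range j.toHom.toFun) : ∃ h' : X ⟶ Y, h' ≫ j = h := by
  choose h' hh' using hr
  have hj := j.toHom.isometry
  refine ⟨⟨⟨h', Isometry.of_dist_eq fun x y => ?_⟩, hj.injective ?_⟩, ?_⟩
  · rw [← hj.dist_eq, hh', hh', h.toHom.isometry.dist_eq]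
  · exact (hh' _).trans (h.map_root.trans j.map_root.symm)
  · apply RBCM.Hom.ext
    apply BCM.Hom.ext
    exact funext hh'

/-- If the triples `T n` converge and their base spaces are embedded into `Y`, then the images in
`τ(Y)` of their elements converge along a subsequence. -/
theorem exists_subseq_tendsto_map (hτ : EmbeddingContinuous τ) {Y : RBCM.{u}} {T : ℕ → Triple τ}
    (f : ∀ n, (T n).base ⟶ Y) {P : Triple τ}
    (hT : ∀ n : ℕ, Triple.ghDist σ (T n) P < ((n : ℝ≥0∞) + 1)⁻¹) :
    ∃ (b : τ.rooted.obj Y) (φ : ℕ → ℕ), StrictMono φ ∧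
      Tendsto (fun n => σ.edist Y ((τ.rooted.map (f (φ n))).toFun (T (φ n)).elem) b)
        atTop (𝓝 0) := by
  choose Z g h hlt hlt' using fun n => (Triple.ghDist_lt_iff σ).1 (hT n)
  -- `U n` contains both `Y` and the limit space `P.base`: the coupling `Z n` is glued to `Y` along
  -- the base of `T n`.
  choose U p q hpq using fun n => RBCM.exists_pushout (f n) (g n)
  have hlim : Tendsto (fun n => localHausdorff (Z n).root (range (h n).toHom.toFun)
      (range (g n).toHom.toFun)) atTop (𝓝 0) :=
    tendsto_of_tendsto_of_tendsto_of_le_of_le tendsto_const_nhds tendsto_inv_succ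
      (fun _ => zero_le) fun n => by
        simp only
        rw [localHausdorff_comm]
        exact (hlt n).le
  -- In `U n`, a point of `P.base` in a given ball is close to the base of `T n`, which is part of
  -- `Y`.
  have hnear : ∀ R ε : ℝ, 0 < ε → ∀ᶠ n in atTop, ∀ x,
      dist ((h n ≫ q n).toHom.toFun x) (U n).root ≤ R →
        ∃ y, dist ((h n ≫ q n).toHom.toFun x) ((p n).toHom.toFun y) ≤ ε := by
    intro R ε hε
    filter_upwards [eventually_exists_dist_lt hlim R hε] with n hn x hx
    have hq := (q n).toHom.isometry
    obtain ⟨_, ⟨x', rfl⟩, hx'⟩ := hn _ ⟨x, rfl⟩ (by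
      rw [← hq.dist_eq, (q n).map_root]
      exact hx)
    refine ⟨(f n).toHom.toFun x', ?_⟩
    change dist ((h n ≫ q n).toHom.toFun x) ((f n ≫ p n).toHom.toFun x') ≤ ε
    rw [hpq, RBCM.dist_comp_comp]
    exact hx'.le
  obtain ⟨V, j, k, hV⟩ := RBCM.exists_common_space (fun n => h n ≫ q n) p hnear
  obtain ⟨H, φ, hφ, hH⟩ := RBCM.exists_subseq_tendstoUniformlyOn k
  -- The point `H x` is approximated by points `k (φ n) x`, which approach `Y`. The image of `Y` is
  -- closed.
  have hrange : ∀ x, H.toHom.toFun x ∈ range j.toHom.toFun := by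
    intro x
    have hcl : IsClosed (range j.toHom.toFun) := j.toHom.isometry.isClosedEmbedding.isClosed_range
    rw [← hcl.closure_eq, Metric.mem_closure_iff]
    intro ε hε
    have h1 := Metric.tendstoUniformlyOn_iff.1 (hH {x} isCompact_singleton) (ε / 2) (half_pos hε)
    have h2 := hφ.tendsto_atTop.eventually (hnear (dist x P.base.root) (ε / 2) (half_pos hε))
    obtain ⟨n, hn1, hn2⟩ := (h1.and h2).exists
    obtain ⟨y, hy⟩ := hn2 x (by
      rw [← (h (φ n) ≫ q (φ n)).map_root, (h (φ n) ≫ q (φ n)).toHom.isometry.dist_eq])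
    obtain ⟨W, f', g', e, l, hf', hg', hk, hj⟩ := hV (φ n)
    refine ⟨j.toHom.toFun y, ⟨y, rfl⟩, ?_⟩
    have hky : dist ((k (φ n)).toHom.toFun x) (j.toHom.toFun y) ≤ ε / 2 := by
      rw [← hf', ← hg', RBCM.dist_comp_comp] at hy
      rwa [← hk, ← hj, RBCM.dist_comp_comp]
    have htri := dist_triangle (H.toHom.toFun x) ((k (φ n)).toHom.toFun x) (j.toHom.toFun y)
    linarith [hn1 x rfl]
  obtain ⟨H', hH'⟩ := RBCM.exists_factor j H hrange
  -- The space `W` maps to both `V` and `U n`, so the distance in τ(V) equals the one in τ(U n),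
  -- which in turn is that of the coupling `Z n`.
  have hclose : ∀ n, σ.edist V ((τ.rooted.map (f n ≫ j)).toFun (T n).elem)
      ((τ.rooted.map (k n)).toFun P.elem) < ((n : ℝ≥0∞) + 1)⁻¹ := by
    intro n
    obtain ⟨W, f', g', e, l, hf', hg', hk, hj⟩ := hV n
    rw [← hk, ← hj, ← Category.assoc, σ.edist_map_comp, ← σ.edist_map_comp _ _ e, Category.assoc,
      hf', hg', hpq, σ.edist_map_comp]
    exact hlt' n
  have hcont : Tendsto (fun n => σ.edist V ((τ.rooted.map (k (φ n))).toFun P.elem)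
      ((τ.rooted.map H).toFun P.elem)) atTop (𝓝 0) :=
    (σ.tendsto_iff V).1 (hτ P.base.space V.space (fun n => (k (φ n)).toHom) H.toHom hH P.elem)
  refine ⟨(τ.rooted.map H').toFun P.elem, φ, hφ, ?_⟩
  have hsum := (tendsto_inv_succ.comp hφ.tendsto_atTop).add hcont
  rw [add_zero] at hsum
  refine tendsto_of_tendsto_of_tendsto_of_le_of_le tendsto_const_nhds hsum (fun _ => zero_le)
    fun n => ?_
  simp only
  -- The map τ_j preserves distances, so convergence in τ(Y) can be checked in τ(V), where the limit
  -- becomes τ_H of the element of `P`.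
  rw [← σ.edist_map_comp _ _ j, hH']
  exact (σ.edist_triangle V _ _ _).trans (add_le_add_left (hclose (φ n)).le _)

/-- The smallest subfunctor of `τ^•` containing the given elements. -/
def MSubfunctor.generate {A : Type w} (T : A → Triple τ) : MSubfunctor τ.rooted where
  obj Y := {b | ∃ (α : A) (f : (T α).base ⟶ Y), (τ.rooted.map f).toFun (T α).elem = b}
  map_mem := by
    rintro X Y g _ ⟨α, f, rfl⟩
    exact ⟨α, f ≫ g, τ.map_comp_apply f g _⟩

theorem MSubfunctor.mem_generate {A : Type w} (T : A → Triple τ) (α : A) :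
    (T α).elem ∈ (MSubfunctor.generate T).obj (T α).base :=
  ⟨α, 𝟙 _, congrArg (fun h => MTop.Hom.toFun h (T α).elem) (τ.rooted.map_id _)⟩

/-! ### Sequential criteria and the two implications -/

theorem isPrecompact_rooted_iff {s : Set RootedGH.{u}} :
    IsPrecompact RootedGH.topology s ↔ ∀ x : ℕ → RootedGH.{u}, (∀ n, x n ∈ s) →
      ∃ (a : RootedGH.{u}) (φ : ℕ → ℕ), StrictMono φ ∧
        Tendsto (fun n => RootedGH.dist (x (φ n)) a) atTop (𝓝 0) :=
  isPrecompact_distTopology_iff RootedGH.dist_self RootedGH.dist_comm RootedGH.dist_triangle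

theorem isPrecompact_ghSpace_iff {s : Set (GHSpace τ)} :
    IsPrecompact (GHSpace.topology σ) s ↔ ∀ x : ℕ → GHSpace τ, (∀ n, x n ∈ s) →
      ∃ (a : GHSpace τ) (φ : ℕ → ℕ), StrictMono φ ∧
        Tendsto (fun n => GHSpace.dist σ (x (φ n)) a) atTop (𝓝 0) :=
  isPrecompact_distTopology_iff (GHSpace.dist_self σ) (GHSpace.dist_comm σ)
    (GHSpace.dist_triangle σ)

theorem isPrecompact_toRooted {s : Set (GHSpace τ)} (hs : IsPrecompact (GHSpace.topology σ) s) :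
    IsPrecompact RootedGH.topology (GHSpace.toRooted '' s) := by
  rw [isPrecompact_rooted_iff]
  intro x hx
  choose p hp hpx using hx
  obtain ⟨a, φ, hφ, ha⟩ := (isPrecompact_ghSpace_iff σ).1 hs p hp
  refine ⟨a.toRooted, φ, hφ, tendsto_of_tendsto_of_tendsto_of_le_of_le tendsto_const_nhds ha
    (fun _ => zero_le) fun n => ?_⟩
  simp only
  rw [← hpx]
  exact GHSpace.dist_toRooted_le σ _ _

theorem isPrecompact_generate (hτ : EmbeddingContinuous τ) {A : Type w} (T : A → Triple τ)
    (hT : IsPrecompact (GHSpace.topology σ) (range fun α => Quotient.mk (Triple.setoid τ) (T α))) :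
    (MSubfunctor.generate T).IsPrecompact := by
  intro Y
  rw [σ.isPrecompact_iff]
  intro x hx
  choose α f hf using hx
  obtain ⟨p, φ, hφ, hp⟩ := (isPrecompact_ghSpace_iff σ).1 hT (fun n => Quotient.mk _ (T (α n)))
    fun n => ⟨α n, rfl⟩
  obtain ⟨ψ, hψ, hlt⟩ := exists_subseq_lt hp
  obtain ⟨P, rfl⟩ := Quotient.exists_rep p
  obtain ⟨b, χ, hχ, hb⟩ := exists_subseq_tendsto_map σ hτ (T := fun n => T (α (φ (ψ n))))
    (fun n => f (φ (ψ n))) (P := P) hlt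
  refine ⟨b, φ ∘ ψ ∘ χ, hφ.comp (hψ.comp hχ), ?_⟩
  simpa only [hf, Function.comp_apply] using hb

theorem isPrecompact_of_upperSemicontinuous (husc : UpperSemicontinuous τ) {s : Set (GHSpace τ)}
    (hs : IsPrecompact RootedGH.topology (GHSpace.toRooted '' s)) {τ' : MSubfunctor τ.rooted}
    (hτ' : τ'.IsPrecompact) (hsub : s ⊆ GHSpace.ofSubfunctor τ') :
    IsPrecompact (GHSpace.topology σ) s := by
  rw [isPrecompact_ghSpace_iff]
  intro x hx
  choose T hT hTmem using fun n => hsub (hx n)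
  obtain ⟨p, φ, hφ, hp⟩ := isPrecompact_rooted_iff.1 hs (fun n => (x n).toRooted)
    fun n => ⟨x n, hx n, rfl⟩
  obtain ⟨ψ, hψ, hlt⟩ := exists_subseq_lt hp
  obtain ⟨X, rfl⟩ := Quotient.exists_rep p
  have hlt' : ∀ n : ℕ, RBCM.ghDist (T (φ (ψ n))).base X < ((n : ℝ≥0∞) + 1)⁻¹ := fun n => by
    have h := hlt n
    rw [← hT] at h
    exact h
  choose Z f g hfg using fun n => RBCM.ghDist_lt_iff.1 (hlt' n)
  have hlim : Tendsto (fun n => localHausdorff (Z n).root (range (f n).toHom.toFun)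
      (range (g n).toHom.toFun)) atTop (𝓝 0) :=
    tendsto_of_tendsto_of_tendsto_of_le_of_le tendsto_const_nhds tendsto_inv_succ
      (fun _ => zero_le) fun n => (hfg n).le
  -- The couplings are glued along the limit `X`, so that all spaces of the subsequence sit in one
  -- `V` together with a fixed copy of `X`.
  obtain ⟨V, j, k, hV⟩ := RBCM.exists_common_space f g fun R ε hε => by
    filter_upwards [eventually_exists_dist_lt hlim R hε] with n hn x hx
    obtain ⟨_, ⟨y, rfl⟩, hy⟩ := hn _ ⟨x, rfl⟩ hx
    exact ⟨y, hy.le⟩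
  have hlimV : Tendsto (fun n => localHausdorff V.root (range (k n).toHom.toFun)
      (range j.toHom.toFun)) atTop (𝓝 0) := by
    refine hlim.congr fun n => ?_
    obtain ⟨W, f', g', e, l, hf', hg', hk, hj⟩ := hV n
    rw [← hf', ← hg', ← hk, ← hj, localHausdorff_range_comp, localHausdorff_range_comp]
  -- Functoriality of `τ'` carries all the elements into the single precompact set `τ'.obj V`.
  obtain ⟨b, χ, hχ, hb⟩ := (σ.isPrecompact_iff V).1 (hτ' V)
    (fun n => (τ.rooted.map (k n)).toFun (T (φ (ψ n))).elem) fun n => τ'.map_mem _ (hTmem _)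
  have hlimχ := hlimV.comp hχ.tendsto_atTop
  obtain ⟨a, rfl⟩ := husc V.space (fun n => (T (φ (ψ (χ n)))).base.space) X.space
    (fun n => (k (χ n)).toHom) j.toHom (tendsto_fellTopology (fun n => k (χ n)) j hlimχ)
    (fun n => (T (φ (ψ (χ n)))).elem) b ((σ.tendsto_iff V).2 hb)
  -- The embeddings into `V` serve as the coupling that bounds the distance to the limit triple:
  -- both terms of the maximum tend to 0.
  refine ⟨Quotient.mk _ ⟨X, a⟩, φ ∘ ψ ∘ χ, hφ.comp (hψ.comp hχ), ?_⟩
  have hmax := hlimχ.max hb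
  rw [max_self] at hmax
  refine tendsto_of_tendsto_of_tendsto_of_le_of_le tendsto_const_nhds hmax (fun _ => zero_le)
    fun n => ?_
  simp only [Function.comp_apply]
  rw [← hT]
  exact Triple.ghDist_le_max σ (𝒴 := ⟨X, a⟩) (k (χ n)) j

end GHStruct

theorem mainTheorem7 (τ : GHStruct.Structure.{u, v}) (σ : GHStruct.SpaceRootedMetrization τ)
    (hτ : GHStruct.EmbeddingContinuous τ)
    {A : Type w} [Nonempty A] (𝒳 : A → GHStruct.GHSpace τ) :
    (GHStruct.IsPrecompact (GHStruct.GHSpace.topology σ) (Set.range 𝒳) →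
      GHStruct.IsPrecompact GHStruct.RootedGH.topology
          (Set.range fun α => (𝒳 α).toRooted) ∧
        ∃ τ' : GHStruct.MSubfunctor τ.rooted,
          τ'.IsPrecompact ∧ Set.range 𝒳 ⊆ GHStruct.GHSpace.ofSubfunctor τ') ∧
    (GHStruct.UpperSemicontinuous τ →
      (GHStruct.IsPrecompact GHStruct.RootedGH.topology
          (Set.range fun α => (𝒳 α).toRooted) ∧
        ∃ τ' : GHStruct.MSubfunctor τ.rooted,
          τ'.IsPrecompact ∧ Set.range 𝒳 ⊆ GHStruct.GHSpace.ofSubfunctor τ') →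
      GHStruct.IsPrecompact (GHStruct.GHSpace.topology σ) (Set.range 𝒳)) := by
  have hrange : (Set.range fun α => (𝒳 α).toRooted) = GHStruct.GHSpace.toRooted '' Set.range 𝒳 :=
    Set.range_comp _ _
  rw [hrange]
  refine ⟨fun h => ⟨GHStruct.isPrecompact_toRooted σ h, ?_⟩, fun husc ⟨h, τ', hτ', hsub⟩ =>
    GHStruct.isPrecompact_of_upperSemicontinuous σ husc h hτ' hsub⟩
  choose T hT using fun α => Quotient.exists_rep (𝒳 α)
  refine ⟨GHStruct.MSubfunctor.generate T, GHStruct.isPrecompact_generate σ hτ T ?_, ?_⟩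
  · simpa only [hT] using h
  · rintro _ ⟨α, rfl⟩
    exact ⟨T α, hT α, GHStruct.MSubfunctor.mem_generate T α⟩
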